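/- Reals are infinite binary sequences, i.e. elements of $2^\omega$ (equivalently, sets of natural numbers), and $\mu$ is the Lebesgue measure on $2^\omega$, given by $\mu[\sigma]=2^{-|\sigma|}$, where $[\sigma]$ is the set of reals extending the finite string $\sigma$. For a real $A$, a Schnorr test relative to $A$ is a sequence $(U_n)_{n\in\omega}$ of $\Sigma^{0,A}_1$ classes, uniformly in $n$, such that $\mu U_n\le 2^{-n}$ and $\mu U_n$ is an $A$-computable real number, uniformly in $n$; $\mathrm{SR}^A$ denotes the class of all reals $Z$ that are Schnorr random relative to $A$, i.e. such that for each Schnorr test $(U_n)_n$ relative to $A$ there is an $n$ with $Z\notin U_n$. A real $A$ is hyperimmune-free if for each function $g:\omega\to\omega$ with $g\le_T A$ there is a computable $f:\omega\to\omega$ with $g(x)\le f(x)$ for all $x$. A real $A$ is array computable if there is a function $f:\omega\to\omega$ with $f\le_{wtt}\emptyset'$ such that every function $g:\omega\to\omega$ with $g\le_T A$ satisfies $g(x)\le f(x)$ for almost all $x$. Finally, $\Omega$ denotes (the binary expansion of) the halting probability $\sum_{\sigma\in\mathrm{dom}\,U}2^{-|\sigma|}$ of a universal prefix machine $U$. Theorem.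 For each real $X$ there is a hyperimmune-free real $A$ such that no real computable from $X$ is in $\mathrm{SR}^A$. Moreover, every hyperimmune-free real is array computable. In particular, for every choice of the universal prefix machine $U$ defining $\Omega$, there is an array computable real $A$ such that $\Omega\notin\mathrm{SR}^A$. -/

import Mathlib

open MeasureTheory Filter

noncomputable section

/-! Reals are infinite binary sequences, i.e. elements of `ℕ → Bool`. -/

namespace Schnorr

/-- The real `A` as an oracle: the characteristic function of a set of natural numbers. -/
def oracle (A : ℕ → Bool) : ℕ →. ℕ := fun n => Part.some (A n).toNat

/-- The total function `f` is computable from the real `A`, i.e. `f ≤_T A`. -/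
def ComputableFrom {α σ : Type} [Primcodable α] [Primcodable σ] (A : ℕ → Bool) (f : α → σ) :
    Prop :=
  ComputableIn {oracle A} f

/-- The predicate `p` is recursively enumerable relative to the real `A`. -/
def REFrom {α : Type} [Primcodable α] (A : ℕ → Bool) (p : α → Prop) : Prop :=
  RecursiveIn {oracle A} fun a => Part.assert (p a) fun _ => Part.some ()

/-- The prefix of `Z` consisting of its first `n` bits `Z 0, …, Z (n - 1)`. -/
def restrict (Z : ℕ → Bool) (n : ℕ) : List Bool := (List.range n).map Z

/-- The basic clopen set of all reals that extend the string `σ`. -/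
def cylinder (σ : List Bool) : Set (ℕ → Bool) := {Z | restrict Z σ.length = σ}

/-- The uniform (Lebesgue) measure on Cantor space: the bits are independent fair coin flips. -/
def lebesgue : Measure (ℕ → Bool) :=
  Measure.infinitePi fun _ : ℕ => (PMF.uniformOfFintype Bool).toMeasure

/-- The measure gives the cylinder of `σ` the mass `2 ^ (-|σ|)`, which is its usual definition. -/
theorem lebesgue_cylinder (σ : List Bool) : lebesgue (cylinder σ) = (2 : ENNReal)⁻¹ ^ σ.length := by
  have h : cylinder σ =
      (Finset.range σ.length : Set ℕ).pi fun i => {b : Bool | b = σ.getD i false} := by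
    ext Z
    simp only [cylinder, restrict, Set.mem_ofPred_eq, Set.mem_pi, Finset.coe_range, Set.mem_Iio]
    constructor
    · intro h i hi
      have h2 : ((List.range σ.length).map Z).getD i false = σ.getD i false := by rw [h]
      rw [← h2]
      simp [List.getD, hi]
    · intro h
      apply List.ext_getElem
      · simp
      · intro i h1 h2
        have := h i h2
        simp [List.getD, h2] at this
        simpa using this
  rw [h, lebesgue, Measure.infinitePi_pi _ (fun i _ => (Set.toFinite _).measurableSet)]
  have h3 : ∀ b : Bool, (PMF.uniformOfFintype Bool).toMeasure {c : Bool | c = b} = 2⁻¹ := by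
    intro b
    have : {c : Bool | c = b} = {b} := rfl
    rw [this, PMF.toMeasure_apply_singleton _ _ (measurableSet_singleton b)]
    simp
  simp only [h3, Finset.prod_const, Finset.card_range]

/-- `U 0, U 1, …` is a sequence of `Σ⁰₁` classes relative to `A`, uniformly: some set of pairs
`(n, σ)` that is recursively enumerable in `A` generates `U n` by the strings `σ` paired
with `n`. -/
def UniformlySigma01 (A : ℕ → Bool) (U : ℕ → Set (ℕ → Bool)) : Prop :=
  ∃ W : ℕ × List Bool → Prop, REFrom A W ∧ ∀ n, U n = ⋃ σ ∈ {σ | W (n, σ)}, cylinder σ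

/-- The sequence of nonnegative real numbers `r 0, r 1, …` is computable relative to `A`,
uniformly: from `n` and `k` the oracle `A` computes a dyadic rational of denominator `2 ^ k`
within `2 ^ (-k)` of `r n`. -/
def UniformlyComputableReals (A : ℕ → Bool) (r : ℕ → ℝ) : Prop :=
  ∃ q : ℕ × ℕ → ℕ, ComputableFrom A q ∧
    ∀ n k, |r n - (q (n, k) : ℝ) / 2 ^ k| ≤ 1 / 2 ^ k

/-- A Martin-Löf test relative to `A`. -/
def IsMartinLofTest (A : ℕ → Bool) (U : ℕ → Set (ℕ → Bool)) : Prop :=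
  UniformlySigma01 A U ∧ ∀ n, lebesgue (U n) ≤ (2 : ENNReal)⁻¹ ^ n

/-- A Schnorr test relative to `A`. -/
def IsSchnorrTest (A : ℕ → Bool) (U : ℕ → Set (ℕ → Bool)) : Prop :=
  IsMartinLofTest A U ∧ UniformlyComputableReals A fun n => (lebesgue (U n)).toReal

/-- The class `SR^A` of the reals that are Schnorr random relative to `A`. -/
def SR (A : ℕ → Bool) : Set (ℕ → Bool) :=
  {Z | ∀ U, IsSchnorrTest A U → ∃ n, Z ∉ U n}

/-- Every function computable from `A` is bounded by a computable function. -/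
def HyperimmuneFree (A : ℕ → Bool) : Prop :=
  ∀ g : ℕ → ℕ, ComputableFrom A g → ∃ f : ℕ → ℕ, Computable f ∧ ∀ x, g x ≤ f x

/-- The halting problem `∅'`: the set of all `e` such that the `e`-th partial recursive function
is defined at `e`. -/
def haltingSet : ℕ → Bool := by
  classical
  exact fun e => decide ((Nat.Partrec.Code.eval (Denumerable.ofNat Nat.Partrec.Code e) e).Dom)

/-- Weak truth-table reducibility `f ≤_wtt B` of a function to a real: there are a computable
bound `u` on the use and a partial computable procedure that computes `f x` from `x` and the
first `u x` bits of the oracle `B`. -/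
def WttReducible (f : ℕ → ℕ) (B : ℕ → Bool) : Prop :=
  ∃ u : ℕ → ℕ, Computable u ∧ ∃ φ : ℕ × List Bool →. ℕ, Partrec φ ∧
    ∀ x, f x ∈ φ (x, restrict B (u x))

/-- Some `f ≤_wtt ∅'` bounds every function computable from `A` on almost all inputs. -/
def ArrayComputable (A : ℕ → Bool) : Prop :=
  ∃ f : ℕ → ℕ, WttReducible f haltingSet ∧
    ∀ g : ℕ → ℕ, ComputableFrom A g → ∀ᶠ x in atTop, g x ≤ f x

/-- A prefix machine: a partial computable function from strings to strings whose domain is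
prefix-free. -/
def IsPrefixMachine (M : List Bool →. List Bool) : Prop :=
  Partrec M ∧ ∀ σ τ, (M σ).Dom → (M τ).Dom → σ <+: τ → σ = τ

/-- A universal prefix machine: for every prefix machine `M` there is a constant `c` such that
each `M`-description of a string can be replaced by a `U`-description of that string which is
longer by at most `c`. -/
def IsUniversalPrefixMachine (U : List Bool →. List Bool) : Prop :=
  IsPrefixMachine U ∧ ∀ M, IsPrefixMachine M →
    ∃ c : ℕ, ∀ σ y, y ∈ M σ → ∃ τ, y ∈ U τ ∧ τ.length ≤ σ.length + c

/-- The halting probability of a prefix machine, as a real number. -/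
def haltingProbability (U : List Bool →. List Bool) : ℝ :=
  ∑' σ : {σ : List Bool // (U σ).Dom}, (1 / 2 : ℝ) ^ σ.1.length

/-- The binary expansion of the fractional part of `x`; bit `n` has the weight `2 ^ (-(n + 1))`. -/
def binaryExpansion (x : ℝ) : ℕ → Bool := fun n => decide (⌊x * 2 ^ (n + 1)⌋ % 2 = 1)

/-- The halting probability `Ω` of the prefix machine `U`, as an infinite binary sequence. -/
def Omega (U : List Bool →. List Bool) : ℕ → Bool := binaryExpansion (haltingProbability U)

end Schnorr

end

/-! The real `A` copies each real `B` computable from `X` infinitely often: for infinitely many `k`,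
the bits `k, …, 2k - 1` of `A` are the first `k` bits of `B`. From `A` one reads off the cylinder of
each block. Those with index above `n` form a set of measure at most `2^(-n)`, and cutting the union
at level `k` loses at most `2^(-k)`, so its measure is computable from `A`. This Schnorr test
captures every `B` so copied (`isSchnorrTest_blockTest`, `notMem_SR_of_frequently`).

Hyperimmune-freeness comes from forcing with computably enumerable trees that let each member `σ` be
followed by any `|σ|` further bits. Given a functional, either some string of the tree has no
extension in it making the functional converge at some input, and one passes above that string; or
convergence can always be reached, and one computes finite levels along which the functional
converges below a computable bound (`Condition.exists_decides`). Both keep the tree bushy, so blocks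
can still be copied between these decisions.

For array computability, take at `x` the sum of all values at `x` of the first `x` partial
computable functions. It dominates every computable function, and computing it needs only boundedly
many bits of the halting set at computable positions. The statement on `Ω` is the case `X = Ω`. -/

noncomputable section

namespace Schnorr

/-! ### Computability relative to a real -/

section Relative

variable {α β γ σ : Type} [Primcodable α] [Primcodable β] [Primcodable γ] [Primcodable σ]
  {O : Set (ℕ →. ℕ)}

theorem _root_.RecursiveIn.comp {f : β →. σ} {g : α → β} (hf : RecursiveIn O f)
    (hg : ComputableIn O g) : RecursiveIn O fun a => f (g a) :=
  (Nat.RecursiveIn.comp hf hg).of_eq fun n => by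
    simp only [Part.bind_eq_bind]
    cases e : Encodable.decode (α := α) n <;> simp

theorem _root_.ComputableIn.comp {f : β → σ} {g : α → β} (hf : ComputableIn O f)
    (hg : ComputableIn O g) : ComputableIn O fun a => f (g a) :=
  RecursiveIn.comp (f := fun b => Part.some (f b)) hf hg

theorem _root_.ComputableIn.pair {f : α → β} {g : α → γ} (hf : ComputableIn O f)
    (hg : ComputableIn O g) : ComputableIn O fun a => (f a, g a) :=
  (Nat.RecursiveIn.pair hf hg).of_eq fun n => by
    cases e : Encodable.decode (α := α) n <;> simp [Seq.seq]

theorem restrict_succ (A : ℕ → Bool) (n : ℕ) : restrict A (n + 1) = restrict A n ++ [A n] := by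
  simp [restrict, List.range_succ]

theorem length_restrict (A : ℕ → Bool) (n : ℕ) : (restrict A n).length = n := by
  simp [restrict]

theorem computableFrom_self (A : ℕ → Bool) : ComputableFrom A A := by
  have h : ComputableIn {oracle A} fun n => (A n).toNat := RecursiveIn.oracle _ rfl
  have h2 : Computable (fun n : ℕ => decide (n = 1)) :=
    (Primrec.eq.comp Primrec.id (Primrec.const 1)).decide.to_comp
  refine (h2.computableIn.comp h).of_eq fun n => ?_
  cases h : A n <;> simp [h]

theorem computableFrom_restrict (A : ℕ → Bool) : ComputableFrom A (restrict A) := by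
  have hstep : ComputableIn {oracle A}
      (fun p : ℕ × ℕ × List Bool => p.2.2 ++ [A p.2.1]) := by
    have h1 : ComputableIn {oracle A} (fun p : ℕ × ℕ × List Bool => (p.2.2, A p.2.1)) :=
      (Computable.snd.comp Computable.snd).computableIn.pair
        ((computableFrom_self A).comp (Computable.fst.comp Computable.snd).computableIn)
    exact (Computable.list_concat (α := Bool)).computableIn.comp h1
  have hz : ComputableIn {oracle A} (fun _ : ℕ => ([] : List Bool)) := .const _
  have h := Nat.RecursiveIn.comp (Nat.RecursiveIn.prec hz hstep)
    -- The recursion scheme expects a parameter paired with the recursion variable; the parameter is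
    -- a dummy `0`.
    (Nat.Primrec.recursiveIn (f := fun n => Nat.pair 0 n)
      (Primrec.nat_iff.1 (Primrec₂.natPair.comp (Primrec.const 0) Primrec.id)))
  refine Nat.RecursiveIn.of_eq h fun n => ?_
  have key : ∀ n : ℕ, (Nat.rec (Part.some (Encodable.encode ([] : List Bool)))
      (fun y IH => IH >>= fun i =>
        ((Encodable.decode (α := ℕ × ℕ × List Bool) (Nat.pair 0 (Nat.pair y i)) :
            Option (ℕ × ℕ × List Bool)) : Part (ℕ × ℕ × List Bool)).bind
          fun p => (Part.some (p.2.2 ++ [A p.2.1])).map Encodable.encode) n : Part ℕ) =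
      Part.some (Encodable.encode (restrict A n)) := by
    intro n
    induction n with
    | zero => simp [restrict]
    | succ n ih =>
      simp only [ih, restrict_succ]
      simp
  have := key n
  simp only [Encodable.decode_nat, Part.coe_some, Part.bind_some, Part.map_some]
  convert this using 1
  simp

/-- What is computed from `a` and a finite part of `A` is computable from `A`. -/
theorem ComputableFrom.of_restrict {A : ℕ → Bool} {F : α × List Bool → σ} {u : α → ℕ}
    (hF : Computable F) (hu : Computable u) :
    ComputableFrom A fun a => F (a, restrict A (u a)) :=
  hF.computableIn.comp (Computable.id.computableIn.pair
    ((computableFrom_restrict A).comp hu.computableIn))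

theorem REFrom.of_computableFrom {A : ℕ → Bool} {p : α → Prop} {t : α → Bool}
    (ht : ComputableFrom A t) (h : ∀ a, p a ↔ t a = true) : REFrom A p := by
  have h1 : Partrec fun b : Bool => Part.assert (b = true) fun _ => Part.some () :=
    (Partrec.cond Computable.id (Partrec.some.comp (Computable.const ())) Partrec.none).of_eq
      fun b => by cases b <;> simp [Part.assert_pos, Part.assert_neg]
  exact (h1.recursiveIn.comp ht).of_eq fun a => by rw [propext (h a)]

end Relative

/-! ### The use principle -/

section Use

/-- `φ`, run on longer and longer prefixes of `A`, computes `f`. -/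
structure Approximates (A : ℕ → Bool) (φ : List Bool → ℕ →. ℕ) (f : ℕ →. ℕ) : Prop where
  partrec : Partrec₂ φ
  mono : ∀ ⦃m n x y⦄, m ≤ n → y ∈ φ (restrict A m) x → y ∈ φ (restrict A n) x
  mem_iff : ∀ x y, y ∈ f x ↔ ∃ n, y ∈ φ (restrict A n) x

/-- Monotonicity turns one good prefix into all longer ones, so that finitely many computations can
share a prefix. -/
theorem Approximates.eventually {A : ℕ → Bool} {φ : List Bool → ℕ →. ℕ} {f : ℕ →. ℕ}
    (h : Approximates A φ f) {x y : ℕ} (hy : y ∈ f x) :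
    ∀ᶠ n in atTop, y ∈ φ (restrict A n) x := by
  obtain ⟨n, hn⟩ := (h.mem_iff x y).1 hy
  filter_upwards [eventually_ge_atTop n] with m hm using h.mono hm hn

theorem Approximates.of_partrec {A : ℕ → Bool} {f : ℕ →. ℕ} (hf : Nat.Partrec f) :
    Approximates A (fun _ x => f x) f :=
  ⟨(Partrec.nat_iff.2 hf).comp Computable.snd, fun _ _ _ _ _ h => h, fun _ _ => by simp⟩

/-- A query beyond the end of the string is left undefined; a default answer could be wrong and
would break monotonicity. -/
theorem Approximates.oracle (A : ℕ → Bool) :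
    Approximates A (fun τ x => ((τ[x]?.map Bool.toNat : Option ℕ) : Part ℕ)) (oracle A) := by
  have key : ∀ n x y, y ∈ (((restrict A n)[x]?.map Bool.toNat : Option ℕ) : Part ℕ) ↔
      x < n ∧ y = (A x).toNat := by
    intro n x y
    by_cases h : x < n <;> simp [restrict, h]
  refine ⟨?_, ?_, ?_⟩
  · have ht : Computable Bool.toNat := (Primrec.dom_finite _).to_comp
    exact Computable.ofOption (Computable.option_map
      (Computable.list_getElem?.comp Computable.fst Computable.snd) (ht.comp Computable.snd).to₂)
  · intro m n x y hmn
    simp only [key]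
    exact fun h => ⟨h.1.trans_le hmn, h.2⟩
  · intro x y
    simp only [key, Schnorr.oracle, Part.mem_some_iff]
    exact ⟨fun h => ⟨x + 1, by omega, h⟩, fun ⟨_, _, h⟩ => h⟩

theorem Approximates.pair {A : ℕ → Bool} {φ ψ : List Bool → ℕ →. ℕ} {f g : ℕ →. ℕ}
    (hf : Approximates A φ f) (hg : Approximates A ψ g) :
    Approximates A (fun τ x => Nat.pair <$> φ τ x <*> ψ τ x)
      (fun x => Nat.pair <$> f x <*> g x) := by
  have e : ∀ (a b : Part ℕ) y, y ∈ (Nat.pair <$> a <*> b) ↔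
      ∃ i ∈ a, ∃ j ∈ b, y = Nat.pair i j := by
    intro a b y
    simp [Seq.seq, eq_comm]
  refine ⟨?_, ?_, ?_⟩
  · have h : Partrec fun p : List Bool × ℕ => (φ p.1 p.2).bind fun i =>
        (ψ p.1 p.2).map fun j => Nat.pair i j :=
      hf.partrec.bind (Partrec.map (hg.partrec.comp (Computable.fst.comp Computable.fst)
        (Computable.snd.comp Computable.fst))
        (Primrec₂.natPair.to_comp.comp
          (Computable.snd.comp Computable.fst) Computable.snd).to₂).to₂
    exact h.of_eq fun p => by simp [Seq.seq]
  · intro m n x y hmn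
    simp only [e]
    rintro ⟨i, hi, j, hj, rfl⟩
    exact ⟨i, hf.mono hmn hi, j, hg.mono hmn hj, rfl⟩
  · intro x y
    simp only [e]
    constructor
    · rintro ⟨i, hi, j, hj, rfl⟩
      obtain ⟨n, h1, h2⟩ := ((hf.eventually hi).and (hg.eventually hj)).exists
      exact ⟨n, i, h1, j, h2, rfl⟩
    · rintro ⟨n, i, hi, j, hj, rfl⟩
      exact ⟨i, (hf.mem_iff _ _).2 ⟨n, hi⟩, j, (hg.mem_iff _ _).2 ⟨n, hj⟩, rfl⟩

theorem Approximates.comp {A : ℕ → Bool} {φ ψ : List Bool → ℕ →. ℕ} {f g : ℕ →. ℕ}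
    (hf : Approximates A φ f) (hg : Approximates A ψ g) :
    Approximates A (fun τ x => (ψ τ x).bind fun i => φ τ i) (fun x => (g x).bind fun i => f i) := by
  refine ⟨?_, ?_, ?_⟩
  · exact hg.partrec.bind
      (hf.partrec.comp (Computable.fst.comp Computable.fst) Computable.snd).to₂
  · intro m n x y hmn
    simp only [Part.mem_bind_iff]
    rintro ⟨i, hi, hy⟩
    exact ⟨i, hg.mono hmn hi, hf.mono hmn hy⟩
  · intro x y
    simp only [Part.mem_bind_iff]
    constructor
    · rintro ⟨i, hi, hy⟩
      obtain ⟨n, h1, h2⟩ := ((hg.eventually hi).and (hf.eventually hy)).exists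
      exact ⟨n, i, h1, h2⟩
    · rintro ⟨n, i, hi, hy⟩
      exact ⟨i, (hg.mem_iff _ _).2 ⟨n, hi⟩, (hf.mem_iff _ _).2 ⟨n, hy⟩⟩

theorem Approximates.prec {A : ℕ → Bool} {φ ψ : List Bool → ℕ →. ℕ} {f g : ℕ →. ℕ}
    (hf : Approximates A φ f) (hg : Approximates A ψ g) :
    Approximates A
      (fun τ p => (Nat.unpair p).2.rec (φ τ (Nat.unpair p).1) fun y IH => do
        let i ← IH
        ψ τ (Nat.pair (Nat.unpair p).1 (Nat.pair y i)))
      (fun p => (Nat.unpair p).2.rec (f (Nat.unpair p).1) fun y IH => do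
        let i ← IH
        g (Nat.pair (Nat.unpair p).1 (Nat.pair y i))) := by
  refine ⟨?_, ?_, ?_⟩
  · have h1 : Computable fun p : List Bool × ℕ => (Nat.unpair p.2).2 :=
      Computable.snd.comp (Computable.unpair.comp Computable.snd)
    have h2 : Computable fun p : List Bool × ℕ => (Nat.unpair p.2).1 :=
      Computable.fst.comp (Computable.unpair.comp Computable.snd)
    refine Partrec.nat_rec (h := fun p q => ψ p.1
        (Nat.pair (Nat.unpair p.2).1 (Nat.pair q.1 q.2))) h1
      (hf.partrec.comp Computable.fst h2) ?_
    exact (hg.partrec.comp (Computable.fst.comp Computable.fst)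
      (Primrec₂.natPair.to_comp.comp (h2.comp Computable.fst)
        (Primrec₂.natPair.to_comp.comp (Computable.fst.comp Computable.snd)
          (Computable.snd.comp Computable.snd)))).to₂
  · intro m n p y hmn
    generalize (Nat.unpair p).1 = a
    generalize (Nat.unpair p).2 = b
    induction b generalizing y with
    | zero => exact fun h => hf.mono hmn h
    | succ b ih =>
      simp only [Part.bind_eq_bind, Part.mem_bind_iff]
      rintro ⟨i, hi, hy⟩
      exact ⟨i, ih hi, hg.mono hmn hy⟩
  · intro p y
    generalize (Nat.unpair p).1 = a
    generalize (Nat.unpair p).2 = b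
    constructor
    -- The induction needs "for all large `n`", since the stages of the recursion must converge on a
    -- common prefix.
    · suffices h : y ∈ (b.rec (f a) (fun y IH => IH >>= fun i => g (Nat.pair a (Nat.pair y i))) :
          Part ℕ) → ∀ᶠ n in atTop, y ∈ (b.rec (φ (restrict A n) a) (fun y IH => IH >>= fun i =>
          ψ (restrict A n) (Nat.pair a (Nat.pair y i))) : Part ℕ) from fun hy => (h hy).exists
      induction b generalizing y with
      | zero => exact fun h => hf.eventually h
      | succ b ih =>
        simp only [Part.bind_eq_bind, Part.mem_bind_iff] at ih ⊢
        rintro ⟨i, hi, hy⟩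
        filter_upwards [ih i hi, hg.eventually hy] with n h1 h2 using ⟨i, h1, h2⟩
    · rintro ⟨n, hn⟩
      induction b generalizing y with
      | zero => exact (hf.mem_iff _ _).2 ⟨n, hn⟩
      | succ b ih =>
        simp only [Part.bind_eq_bind, Part.mem_bind_iff] at ih hn ⊢
        obtain ⟨i, hi, hy⟩ := hn
        exact ⟨i, ih i hi, (hg.mem_iff _ _).2 ⟨n, hy⟩⟩

theorem Approximates.rfind {A : ℕ → Bool} {φ : List Bool → ℕ →. ℕ} {f : ℕ →. ℕ}
    (hf : Approximates A φ f) :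
    Approximates A
      (fun τ a => Nat.rfind fun n => (fun m => decide (m = 0)) <$> φ τ (Nat.pair a n))
      (fun a => Nat.rfind fun n => (fun m => decide (m = 0)) <$> f (Nat.pair a n)) := by
  have e : ∀ (g : ℕ →. ℕ) (y : ℕ), (y ∈ Nat.rfind fun n => (fun m => decide (m = 0)) <$> g n) ↔
      0 ∈ g y ∧ ∀ k < y, ∃ j ∈ g k, j ≠ 0 :=
    fun g y => Nat.mem_rfind.trans (by simp)
  refine ⟨?_, ?_, ?_⟩
  · have hd : Computable fun m : ℕ => decide (m = 0) :=
      (Primrec.eq.comp Primrec.id (Primrec.const 0)).decide.to_comp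
    exact Partrec.rfind (p := fun (q : List Bool × ℕ) n =>
        (φ q.1 (Nat.pair q.2 n)).map fun m => decide (m = 0))
      (Partrec.map (hf.partrec.comp (Computable.fst.comp Computable.fst)
        (Primrec₂.natPair.to_comp.comp (Computable.snd.comp Computable.fst)
          Computable.snd)) (hd.comp Computable.snd).to₂)
  · intro m n x y hmn h
    obtain ⟨h1, h2⟩ := (e (fun k => φ (restrict A m) (Nat.pair x k)) y).1 h
    refine (e (fun k => φ (restrict A n) (Nat.pair x k)) y).2 ⟨hf.mono hmn h1, fun k hk => ?_⟩
    obtain ⟨j, hj, h3⟩ := h2 k hk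
    exact ⟨j, hf.mono hmn hj, h3⟩
  · intro x y
    constructor
    · intro h
      obtain ⟨h1, h2⟩ := (e (fun k => f (Nat.pair x k)) y).1 h
      have h3 : ∀ᶠ n in atTop, ∀ k ∈ Set.Iio y,
          ∃ j ∈ φ (restrict A n) (Nat.pair x k), j ≠ 0 := by
        refine (eventually_all_finite (Set.finite_Iio y)).2 fun k hk => ?_
        obtain ⟨j, hj, h3⟩ := h2 k hk
        filter_upwards [hf.eventually hj] with n hn using ⟨j, hn, h3⟩
      obtain ⟨n, hn, hn3⟩ := ((hf.eventually h1).and h3).exists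
      exact ⟨n, (e (fun k => φ (restrict A n) (Nat.pair x k)) y).2 ⟨hn, hn3⟩⟩
    · rintro ⟨n, h⟩
      obtain ⟨h1, h2⟩ := (e (fun k => φ (restrict A n) (Nat.pair x k)) y).1 h
      refine (e (fun k => f (Nat.pair x k)) y).2 ⟨(hf.mem_iff _ _).2 ⟨n, h1⟩, fun k hk => ?_⟩
      obtain ⟨j, hj, h3⟩ := h2 k hk
      exact ⟨j, (hf.mem_iff _ _).2 ⟨n, hj⟩, h3⟩

/-- The use principle. -/
theorem exists_approximates {A : ℕ → Bool} {f : ℕ →. ℕ}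
    (hf : Nat.RecursiveIn {oracle A} f) : ∃ φ, Approximates A φ f := by
  induction hf with
  | zero => exact ⟨_, .of_partrec .zero⟩
  | succ => exact ⟨_, .of_partrec .succ⟩
  | left => exact ⟨_, .of_partrec .left⟩
  | right => exact ⟨_, .of_partrec .right⟩
  | oracle g hg => rw [Set.mem_singleton_iff.1 hg]; exact ⟨_, .oracle A⟩
  | pair _ _ h1 h2 => exact ⟨_, h1.choose_spec.pair h2.choose_spec⟩
  | comp _ _ h1 h2 => exact ⟨_, h1.choose_spec.comp h2.choose_spec⟩
  | prec _ _ h1 h2 => exact ⟨_, h1.choose_spec.prec h2.choose_spec⟩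
  | rfind _ h => exact ⟨_, h.choose_spec.rfind⟩

/-- The partial computable function with code `c`, run on a finite oracle `τ` and an input. -/
def evalOracle (c : Nat.Partrec.Code) (τ : List Bool) (x : ℕ) : Part ℕ :=
  c.eval (Nat.pair x (Encodable.encode τ))

/-- Codes make the functionals a countable list of tasks that does not depend on `A`, as the forcing
construction requires. -/
theorem exists_code_approximates {A : ℕ → Bool} {f : ℕ →. ℕ}
    (hf : Nat.RecursiveIn {oracle A} f) : ∃ c, Approximates A (evalOracle c) f := by
  obtain ⟨φ, h⟩ := exists_approximates hf
  have h2 : Partrec fun p : ℕ × List Bool => φ p.2 p.1 :=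
    h.partrec.comp Computable.snd Computable.fst
  obtain ⟨c, hc⟩ := Nat.Partrec.Code.exists_code.1 h2
  refine ⟨c, ?_⟩
  have : evalOracle c = φ := by
    funext τ x
    simp [evalOracle, hc, Part.map_id']
  rwa [this]

theorem ComputableFrom.nat {A : ℕ → Bool} {g : ℕ → ℕ} (h : ComputableFrom A g) :
    Nat.RecursiveIn {Schnorr.oracle A} (g : ℕ →. ℕ) :=
  RecursiveIn.iff_nat.1 h

/-- Only countably many reals are computable from `X`. -/
theorem exists_enumeration (X : ℕ → Bool) :
    ∃ B : ℕ → ℕ → Bool, ∀ Y, ComputableFrom X Y → ∃ e, B e = Y := by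
  classical
  -- The list need not be effective: a code that computes no real still yields some sequence. The
  -- output `1` stands for the bit `true`.
  refine ⟨fun e x => decide (∃ n, 1 ∈ evalOracle (Denumerable.ofNat _ e) (restrict X n) x),
    fun Y hY => ?_⟩
  have ht : Computable Bool.toNat := (Primrec.dom_finite _).to_comp
  obtain ⟨c, hc⟩ := exists_code_approximates (ComputableFrom.nat (ht.computableIn.comp hY))
  refine ⟨Encodable.encode c, funext fun x => ?_⟩
  beta_reduce
  rw [Denumerable.ofNat_encode, Bool.eq_iff_iff, decide_eq_true_iff, ← hc.mem_iff]
  cases h : Y x <;> simp [h]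

end Use

/-! ### Enumerations by stages -/

section Enumerable

variable {α : Type} [Primcodable α]

theorem _root_.REPred.of_exists {t : α → ℕ → Bool} (ht : Computable₂ t) {p : α → Prop}
    (h : ∀ a, p a ↔ ∃ k, t a k = true) : REPred p := by
  have h1 : Partrec fun a => Nat.rfind fun k => Part.some (t a k) :=
    Partrec.rfind ht.partrec₂
  exact h1.dom_re.of_eq fun a => by
    rw [h]
    exact Nat.rfind_dom.trans (by simp)

/-- Bounding the number of steps by `evaln` makes each stage decidable. Since stages increase,
finitely many members all appear by a common stage. -/
theorem _root_.REPred.exists_stages {p : α → Prop} (hp : REPred p) :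
    ∃ q : ℕ → α → Prop, PrimrecRel q ∧ (∀ m n a, m ≤ n → q m a → q n a) ∧
      ∀ a, p a ↔ ∃ k, q k a := by
  obtain ⟨c, hc⟩ := Nat.Partrec.Code.exists_code.1 hp
  refine ⟨fun k a => (c.evaln k (Encodable.encode a)).isSome = true, ?_, ?_, fun a => ?_⟩
  · have h : Primrec fun p : ℕ × α => (c.evaln p.1 (Encodable.encode p.2)).isSome :=
      Primrec.option_isSome.comp (Nat.Partrec.Code.primrec_evaln.comp
        ((Primrec.fst.pair (Primrec.const c)).pair (Primrec.encode.comp Primrec.snd)))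
    exact Primrec.eq.comp h (Primrec.const true)
  · intro m n a hmn h
    obtain ⟨y, hy⟩ := Option.isSome_iff_exists.1 h
    exact Option.isSome_iff_exists.2 ⟨y, Nat.Partrec.Code.evaln_mono hmn hy⟩
  · have h1 : p a ↔ ∃ y, y ∈ c.eval (Encodable.encode a) := by
      rw [hc]
      simp
    rw [h1]
    simp only [Nat.Partrec.Code.evaln_complete, Option.isSome_iff_exists]
    exact exists_comm

end Enumerable

/-! ### Hyperimmune-free reals are array computable -/

section ArrayComputable

open Nat.Partrec (Code)

/-- A code that ignores its input and runs the `e`-th code on `x`, as a number. -/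
def specialize (x e : ℕ) : ℕ :=
  Encodable.encode ((Denumerable.ofNat Code e).comp (Code.const x))

theorem computable_specialize : Computable₂ specialize :=
  (Primrec.encode.comp (Code.primrec₂_comp.comp ((Primrec.ofNat Code).comp Primrec.snd)
    (Code.primrec_const.comp Primrec.fst))).to_comp.to₂

/-- The specialized code ignores its input, so running it on itself runs code `e` on `x`.
Convergence at `x` is thus one bit of the halting set at a computable position. -/
theorem haltingSet_specialize (x e : ℕ) :
    haltingSet (specialize x e) = true ↔ ((Denumerable.ofNat Code e).eval x).Dom := by
  classical
  rw [haltingSet]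
  refine decide_eq_true_iff.trans ?_
  rw [specialize, Denumerable.ofNat_encode]
  generalize Encodable.encode ((Denumerable.ofNat Code e).comp (Code.const x)) = z
  change (((Code.const x).eval z).bind fun i => (Denumerable.ofNat Code e).eval i).Dom ↔ _
  rw [Code.eval_const, Part.bind_some]

open Classical in
/-- The sum of the values at `x` of the first `n` partial computable functions, where undefined
values are ignored. -/
def sumEval (x n : ℕ) : ℕ :=
  ∑ e ∈ Finset.range n,
    if h : ((Denumerable.ofNat Code e).eval x).Dom then ((Denumerable.ofNat Code e).eval x).get h
    else 0

theorem sumEval_succ_of_mem {x n y : ℕ} (h : y ∈ (Denumerable.ofNat Code n).eval x) :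
    sumEval x (n + 1) = sumEval x n + y := by
  obtain ⟨h, rfl⟩ := h
  rw [sumEval, Finset.sum_range_succ, ← sumEval, dif_pos h]

theorem sumEval_succ_of_not_dom {x n : ℕ} (h : ¬((Denumerable.ofNat Code n).eval x).Dom) :
    sumEval x (n + 1) = sumEval x n := by
  rw [sumEval, Finset.sum_range_succ, ← sumEval, dif_neg h, add_zero]

theorem le_sumEval {x n e y : ℕ} (he : e < n) (hy : y ∈ (Denumerable.ofNat Code e).eval x) :
    y ≤ sumEval x n := by
  obtain ⟨h, rfl⟩ := hy
  refine le_trans (le_of_eq ?_) (Finset.single_le_sum (fun _ _ => Nat.zero_le _)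
    (Finset.mem_range.2 he))
  rw [dif_pos h]

/-- The bits at the positions `specialize x e` with `e < x` tell which computations converge, and
only those are run. The positions are computable, hence so is a bound on the use. -/
theorem wttReducible_sumEval : WttReducible (fun x => sumEval x x) haltingSet := by
  -- Adding up all positions, each increased by one, gives a bound that strictly exceeds each of
  -- them.
  let u (x n : ℕ) : ℕ := n.rec 0 fun e s => s + (specialize x e + 1)
  have hu (x n e : ℕ) (he : e < n) : specialize x e < u x n := by
    induction n with
    | zero => omega
    | succ n ih =>
      change _ < u x n + (specialize x n + 1)
      rcases Nat.lt_succ_iff_lt_or_eq.1 he with h | rfl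
      · have := ih h
        omega
      · omega
  let φ (x : ℕ) (τ : List Bool) (n : ℕ) : Part ℕ :=
    n.rec (Part.some 0) fun e IH => IH.bind fun s =>
      cond (τ.getD (specialize x e) false)
        (((Denumerable.ofNat Code e).eval x).map fun y => s + y) (Part.some s)
  refine ⟨fun x => u x x, ?_, fun p => φ p.1 p.2 p.1, ?_, fun x => ?_⟩
  · exact Computable.nat_rec (h := fun x q => q.2 + (specialize x q.1 + 1)) Computable.id
      (Computable.const 0)
      (Primrec.nat_add.to_comp.comp (Computable.snd.comp Computable.snd)
        (Computable.succ.comp (computable_specialize.comp Computable.fst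
          (Computable.fst.comp Computable.snd)))).to₂
  · refine Partrec.nat_rec (h := fun (p : ℕ × List Bool) q =>
      cond (p.2.getD (specialize p.1 q.1) false)
        (((Denumerable.ofNat Code q.1).eval p.1).map fun y => q.2 + y) (Part.some q.2))
      Computable.fst (Computable.const 0) ?_
    refine Partrec.cond ?_ ?_ (Computable.snd.comp Computable.snd)
    · exact (Primrec.list_getD false).to_comp.comp (Computable.snd.comp Computable.fst)
        (computable_specialize.comp (Computable.fst.comp Computable.fst)
          (Computable.fst.comp Computable.snd))
    · exact Partrec.map (Code.eval_part.comp
        ((Computable.ofNat Code).comp (Computable.fst.comp Computable.snd))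
          (Computable.fst.comp Computable.fst))
        (Primrec.nat_add.to_comp.comp
          (Computable.snd.comp (Computable.snd.comp Computable.fst)) Computable.snd).to₂
  · have key : ∀ n ≤ x, φ x (restrict haltingSet (u x x)) n = Part.some (sumEval x n) := by
      intro n
      induction n with
      | zero => intro _; simp [φ, sumEval]
      | succ n ih =>
        intro hn
        have h1 : (restrict haltingSet (u x x)).getD (specialize x n) false =
            haltingSet (specialize x n) := by
          simp [restrict, List.getD, hu x x n hn]
        change (φ x (restrict haltingSet (u x x)) n).bind _ = _
        rw [ih (by omega), Part.bind_some, h1]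
        by_cases h : ((Denumerable.ofNat Code n).eval x).Dom
        · obtain ⟨y, hy⟩ := Part.dom_iff_mem.1 h
          rw [(haltingSet_specialize x n).2 h, sumEval_succ_of_mem hy, Part.eq_some_iff.2 hy]
          simp
        · have h2 : haltingSet (specialize x n) = false := by
            rw [← Bool.not_eq_true, haltingSet_specialize]
            exact h
          rw [h2, sumEval_succ_of_not_dom h]
          rfl
    exact Part.eq_some_iff.1 (key x le_rfl)

/-- A computable bound with code `c` is one of the summands of `sumEval x x` as soon as `x` exceeds
the number of `c`. -/
theorem HyperimmuneFree.arrayComputable {A : ℕ → Bool} (hA : HyperimmuneFree A) :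
    ArrayComputable A := by
  refine ⟨_, wttReducible_sumEval, fun g hg => ?_⟩
  obtain ⟨f, hf, hgf⟩ := hA g hg
  obtain ⟨c, hc⟩ := Code.exists_code.1 (Partrec.nat_iff.1 hf)
  filter_upwards [eventually_gt_atTop (Encodable.encode c)] with x hx
  refine (hgf x).trans (le_sumEval hx ?_)
  rw [Denumerable.ofNat_encode, hc]
  exact Part.mem_some _

end ArrayComputable

/-! ### The Schnorr test formed by the blocks of a real -/

section BlockTest

theorem restrict_take {Z : ℕ → Bool} {m n : ℕ} (h : m ≤ n) :
    (restrict Z n).take m = restrict Z m := by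
  simp [restrict, ← List.map_take, List.take_range, h]

theorem measurableSet_cylinder (σ : List Bool) : MeasurableSet (cylinder σ) := by
  have h : cylinder σ =
      ⋂ i ∈ Finset.range σ.length, (fun Z : ℕ → Bool => Z i) ⁻¹' {σ.getD i false} := by
    ext Z
    simp only [cylinder, Set.mem_ofPred_eq, Set.mem_iInter, Finset.mem_range, Set.mem_preimage,
      Set.mem_singleton_iff]
    constructor
    · intro h i hi
      rw [← h]
      simp [restrict, List.getD, hi]
    · intro h
      apply List.ext_getElem (length_restrict _ _)
      intro i h1 h2
      simpa [restrict, List.getD, h2] using h i h2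
  rw [h]
  exact Finset.measurableSet_biInter _ fun i _ => measurable_pi_apply i (measurableSet_singleton _)

theorem cylinder_subset_cylinder {σ τ : List Bool} (h : τ.take σ.length = σ) :
    cylinder τ ⊆ cylinder σ := by
  intro Z hZ
  have hl : σ.length ≤ τ.length := by
    rw [← h]
    simp
  change restrict Z _ = _
  rw [← restrict_take hl, show restrict Z τ.length = τ from hZ, h]

theorem take_eq_of_mem_cylinder {σ τ : List Bool} {Z : ℕ → Bool} (hσ : Z ∈ cylinder σ)
    (hτ : Z ∈ cylinder τ) (h : σ.length ≤ τ.length) : τ.take σ.length = σ := by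
  rw [← show restrict Z τ.length = τ from hτ, restrict_take h]
  exact hσ

/-- The string of the bits `k, …, 2 * k - 1` of `τ`. -/
def listBlock (τ : List Bool) (k : ℕ) : List Bool := (τ.take (2 * k)).drop k

/-- The string of the bits `k, …, 2 * k - 1` of `A`. -/
def block (A : ℕ → Bool) (k : ℕ) : List Bool := listBlock (restrict A (2 * k)) k

theorem length_block (A : ℕ → Bool) (k : ℕ) : (block A k).length = k := by
  simp [block, listBlock, length_restrict]
  omega

theorem listBlock_restrict {A : ℕ → Bool} {k m : ℕ} (h : 2 * k ≤ m) :
    listBlock (restrict A m) k = block A k := by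
  simp [block, listBlock, restrict_take h, restrict_take le_rfl]

/-- The number of strings of length `k` that extend one of the strings `b j` with `n < j ≤ k`,
if `b j` has length `j`. -/
def countExtensions (b : ℕ → List Bool) (n k : ℕ) : ℕ :=
  k.rec 0 fun i s => 2 * s +
    if n ≤ i ∧ ∀ j < i + 1, n < j → (b (i + 1)).take j ≠ b j then 1 else 0

theorem countExtensions_succ (b : ℕ → List Bool) (n k : ℕ) :
    countExtensions b n (k + 1) = 2 * countExtensions b n k +
      if n ≤ k ∧ ∀ j < k + 1, n < j → (b (k + 1)).take j ≠ b j then 1 else 0 := rfl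

theorem countExtensions_congr {b b' : ℕ → List Bool} {n k : ℕ} (h : ∀ j ≤ k, b j = b' j) :
    countExtensions b n k = countExtensions b' n k := by
  induction k with
  | zero => rfl
  | succ k ih =>
    rw [countExtensions_succ, countExtensions_succ, ih fun j hj => h j (by omega), h _ le_rfl]
    congr 2
    refine propext (and_congr_right fun _ => forall₂_congr fun j hj => ?_)
    rw [h j hj.le]

/-- From level `k` to `k + 1` every counted string splits in two, and the cylinder of `b (k + 1)` is
either contained in an earlier one or disjoint from all of them. -/
theorem lebesgue_iUnion_cylinder (b : ℕ → List Bool) (hb : ∀ j, (b j).length = j) (n k : ℕ) :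
    lebesgue (⋃ j ∈ Set.Ioc n k, cylinder (b j)) =
      countExtensions b n k * (2 : ENNReal)⁻¹ ^ k := by
  induction k with
  | zero => simp [countExtensions]
  | succ k ih =>
    have hc : (countExtensions b n k : ENNReal) * 2⁻¹ ^ k =
        (2 * countExtensions b n k : ENNReal) * 2⁻¹ ^ (k + 1) := by
      rw [pow_succ, mul_comm (2 : ENNReal), mul_assoc, mul_left_comm (2 : ENNReal),
        ENNReal.mul_inv_cancel (by simp) (by simp), mul_one]
    by_cases hn : n ≤ k
    · have hI : Set.Ioc n (k + 1) = insert (k + 1) (Set.Ioc n k) := by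
        ext j
        simp only [Set.mem_Ioc, Set.mem_insert_iff]
        omega
      rw [hI, Set.biUnion_insert, countExtensions_succ]
      by_cases h : ∀ j < k + 1, n < j → (b (k + 1)).take j ≠ b j
      · rw [if_pos ⟨hn, h⟩, measure_union' _ (measurableSet_cylinder _), ih, hc,
          lebesgue_cylinder, hb]
        · push_cast
          ring
        · rw [Set.disjoint_left]
          rintro Z hZ hZ'
          simp only [Set.mem_iUnion] at hZ'
          obtain ⟨j, hj, hZj⟩ := hZ'
          refine h j (Nat.lt_succ_of_le hj.2) hj.1 ?_
          have := take_eq_of_mem_cylinder hZj hZ (by rw [hb, hb]; exact hj.2.trans (by omega))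
          rwa [hb] at this
      · rw [if_neg fun h' => h h'.2, Set.union_eq_right.2, ih, hc]
        · push_cast
          ring
        · push Not at h
          obtain ⟨j, hj, hnj, hjb⟩ := h
          refine (cylinder_subset_cylinder (σ := b j) (by rwa [hb])).trans ?_
          exact Set.subset_biUnion_of_mem (u := fun j => cylinder (b j))
            (show j ∈ Set.Ioc n k from ⟨hnj, by omega⟩)
    · rw [countExtensions_succ, if_neg fun h' => hn h'.1]
      have hI : Set.Ioc n (k + 1) = Set.Ioc n k := by
        ext j
        simp only [Set.mem_Ioc]
        omega
      rw [hI, ih, hc]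
      push_cast
      ring

theorem primrec_listBlock : Primrec₂ listBlock :=
  Primrec.list_drop.comp Primrec.snd (Primrec.list_take.comp
    (Primrec.nat_mul.comp (Primrec.const 2) Primrec.snd) Primrec.fst)

theorem primrec_countExtensions :
    Primrec fun p : (ℕ × ℕ) × List Bool => countExtensions (listBlock p.2) p.1.1 p.1.2 := by
  have h1 : PrimrecRel fun (j : ℕ) (q : ((ℕ × ℕ) × List Bool) × ℕ) =>
      q.1.1.1 < j → (listBlock q.1.2 (q.2 + 1)).take j ≠ listBlock q.1.2 j := by
    have h2 : PrimrecPred fun r : ℕ × ((ℕ × ℕ) × List Bool) × ℕ => r.2.1.1.1 < r.1 :=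
      Primrec.nat_lt.comp (Primrec.fst.comp (Primrec.fst.comp (Primrec.fst.comp Primrec.snd)))
        Primrec.fst
    have hτ : Primrec fun r : ℕ × ((ℕ × ℕ) × List Bool) × ℕ => r.2.1.2 :=
      Primrec.snd.comp (Primrec.fst.comp Primrec.snd)
    have h3 : PrimrecPred fun r : ℕ × ((ℕ × ℕ) × List Bool) × ℕ =>
        (listBlock r.2.1.2 (r.2.2 + 1)).take r.1 = listBlock r.2.1.2 r.1 :=
      Primrec.eq.comp
        (Primrec.list_take.comp Primrec.fst
          (primrec_listBlock.comp hτ (Primrec.succ.comp (Primrec.snd.comp Primrec.snd))))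
        (primrec_listBlock.comp hτ Primrec.fst)
    exact (h2.not.or h3.not).of_eq fun r => imp_iff_not_or.symm
  have h4 : PrimrecPred fun q : ((ℕ × ℕ) × List Bool) × ℕ × ℕ =>
      q.1.1.1 ≤ q.2.1 ∧ ∀ j < q.2.1 + 1, q.1.1.1 < j →
        (listBlock q.1.2 (q.2.1 + 1)).take j ≠ listBlock q.1.2 j := by
    refine PrimrecPred.and (Primrec.nat_le.comp
      (Primrec.fst.comp (Primrec.fst.comp Primrec.fst)) (Primrec.fst.comp Primrec.snd)) ?_
    exact (h1.forall_mem_list.comp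
      (Primrec.list_range.comp (Primrec.succ.comp (Primrec.fst.comp Primrec.snd)))
      (Primrec.fst.pair (Primrec.fst.comp Primrec.snd))).of_eq fun q => by simp
  exact Primrec.nat_rec' (h := fun p q => 2 * q.2 +
      if p.1.1 ≤ q.1 ∧ ∀ j < q.1 + 1, p.1.1 < j →
        (listBlock p.2 (q.1 + 1)).take j ≠ listBlock p.2 j then 1 else 0)
    (Primrec.snd.comp Primrec.fst) (Primrec.const 0)
    (Primrec.nat_add.comp (Primrec.nat_mul.comp (Primrec.const 2) (Primrec.snd.comp Primrec.snd))
      (Primrec.ite h4 (Primrec.const 1) (Primrec.const 0)))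

/-- The `n`-th set of the test given by `A`: the union of the cylinders of all blocks of `A` that
are longer than `n`. -/
def blockTest (A : ℕ → Bool) (n : ℕ) : Set (ℕ → Bool) :=
  ⋃ j ∈ Set.Ioi n, cylinder (block A j)

theorem lebesgue_blockTest_le (A : ℕ → Bool) (n : ℕ) :
    lebesgue (blockTest A n) ≤ (2 : ENNReal)⁻¹ ^ n := by
  have h : blockTest A n ⊆ ⋃ i : ℕ, cylinder (block A (n + 1 + i)) := by
    refine Set.iUnion₂_subset fun j hj => ?_
    obtain ⟨i, rfl⟩ := Nat.exists_eq_add_of_le (Nat.succ_le_of_lt hj)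
    exact Set.subset_iUnion (fun i => cylinder (block A (n + 1 + i))) i
  refine (measure_mono h).trans ((measure_iUnion_le _).trans_eq ?_)
  simp only [lebesgue_cylinder, length_block, pow_add, ENNReal.tsum_mul_left,
    ENNReal.tsum_geometric, ENNReal.one_sub_inv_two, inv_inv, pow_one]
  rw [mul_assoc, ENNReal.inv_mul_cancel (by simp) (by simp), mul_one]

/-- The blocks of length at most `k` contribute a dyadic measure with numerator `countExtensions`,
and the remaining ones lie in `blockTest A k`, of measure at most `2^(-k)`. This is exactly the
precision required. -/
theorem isSchnorrTest_blockTest (A : ℕ → Bool) : IsSchnorrTest A (blockTest A) := by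
  refine ⟨⟨⟨fun p => p.1 < p.2.length ∧ p.2 = block A p.2.length, ?_, fun n => ?_⟩,
    lebesgue_blockTest_le A⟩, fun p => countExtensions (block A) p.1 p.2, ?_, fun n k => ?_⟩
  · have hp : PrimrecPred fun q : (ℕ × List Bool) × List Bool =>
        q.1.1 < q.1.2.length ∧ q.1.2 = listBlock q.2 q.1.2.length :=
      PrimrecPred.and
        (Primrec.nat_lt.comp (Primrec.fst.comp Primrec.fst)
          (Primrec.list_length.comp (Primrec.snd.comp Primrec.fst)))
        (Primrec.eq.comp (Primrec.snd.comp Primrec.fst) (primrec_listBlock.comp Primrec.snd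
          (Primrec.list_length.comp (Primrec.snd.comp Primrec.fst))))
    exact REFrom.of_computableFrom
      (ComputableFrom.of_restrict (u := fun p : ℕ × List Bool => 2 * p.2.length)
        hp.decide.to_comp
        (Primrec.nat_mul.comp (Primrec.const 2)
          (Primrec.list_length.comp Primrec.snd)).to_comp) fun p => by simp [block]
  · ext Z
    simp only [blockTest, Set.mem_iUnion, Set.mem_Ioi, Set.mem_ofPred_eq, exists_prop]
    constructor
    · rintro ⟨j, hj, hZ⟩
      exact ⟨block A j, by rw [length_block]; exact ⟨hj, rfl⟩, hZ⟩
    · rintro ⟨σ, ⟨h1, h2⟩, hZ⟩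
      exact ⟨_, h1, h2 ▸ hZ⟩
  · have h := ComputableFrom.of_restrict (A := A) (u := fun p : ℕ × ℕ => 2 * p.2)
      primrec_countExtensions.to_comp
      (Primrec.nat_mul.comp (Primrec.const 2) Primrec.snd).to_comp
    convert h using 2 with p
    exact countExtensions_congr fun j hj => (listBlock_restrict (by omega)).symm
  · set V := ⋃ j ∈ Set.Ioc n k, cylinder (block A j) with hV
    have hVm : lebesgue V = countExtensions (block A) n k * (2 : ENNReal)⁻¹ ^ k :=
      lebesgue_iUnion_cylinder _ (length_block A) n k
    have hVr : (lebesgue V).toReal = (countExtensions (block A) n k : ℝ) / 2 ^ k := by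
      rw [hVm]
      simp [div_eq_mul_inv]
    have hfin : ∀ m, lebesgue (blockTest A m) ≠ ⊤ := fun m =>
      ((lebesgue_blockTest_le A m).trans_lt (by simp)).ne
    have h1 : V ⊆ blockTest A n :=
      Set.biUnion_subset_biUnion_left fun j hj => hj.1
    have h2 : blockTest A n ⊆ V ∪ blockTest A k := by
      refine Set.iUnion₂_subset fun j hj => ?_
      by_cases hjk : j ≤ k
      · exact (Set.subset_biUnion_of_mem (u := fun j => cylinder (block A j))
          (show j ∈ Set.Ioc n k from ⟨hj, hjk⟩)).trans Set.subset_union_left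
      · exact (Set.subset_biUnion_of_mem (u := fun j => cylinder (block A j))
          (show j ∈ Set.Ioi k from not_le.1 hjk)).trans Set.subset_union_right
    have hVfin : lebesgue V ≠ ⊤ := ((measure_mono h1).trans_lt (hfin n).lt_top).ne
    have h3 := ENNReal.toReal_mono (hfin n) (measure_mono h1)
    have h4 : (lebesgue (blockTest A n)).toReal ≤
        (lebesgue V).toReal + (lebesgue (blockTest A k)).toReal := by
      rw [← ENNReal.toReal_add hVfin (hfin k)]
      exact ENNReal.toReal_mono (ENNReal.add_ne_top.2 ⟨hVfin, hfin k⟩)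
        ((measure_mono h2).trans (measure_union_le _ _))
    have h5 : (lebesgue (blockTest A k)).toReal ≤ 1 / 2 ^ k := by
      refine (ENNReal.toReal_mono (by simp) (lebesgue_blockTest_le A k)).trans_eq ?_
      simp
    rw [← hVr, abs_le]
    constructor
    · have : (0 : ℝ) ≤ 1 / 2 ^ k := by positivity
      linarith
    · linarith

/-- A real that agrees with infinitely many blocks of `A` is not Schnorr random relative
to `A`. -/
theorem notMem_SR_of_frequently {A B : ℕ → Bool} (h : ∀ n, ∃ k > n, block A k = restrict B k) :
    B ∉ SR A := by
  intro hB
  obtain ⟨n, hn⟩ := hB _ (isSchnorrTest_blockTest A)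
  obtain ⟨k, hk, hkB⟩ := h n
  refine hn (Set.mem_biUnion (show k ∈ Set.Ioi n from hk) ?_)
  change restrict B _ = _
  rw [length_block, hkB]

end BlockTest

/-! ### Computable sequences by unbounded search -/

section Search

variable {σ : Type} [Primcodable σ]

/-- A sequence obeying a decidable relation between consecutive terms can be found by search. -/
theorem exists_computable_seq {R : ℕ × σ → σ → Prop} (hR : PrimrecRel R) {P : σ → Prop} {a₀ : σ}
    (h₀ : P a₀) (hstep : ∀ n a, P a → ∃ b, R (n, a) b) (hP : ∀ n a b, P a → R (n, a) b → P b) :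
    ∃ s : ℕ → σ, Computable s ∧ s 0 = a₀ ∧ ∀ n, P (s n) ∧ R (n, s n) (s (n + 1)) := by
  classical
  let S (q : ℕ × σ) (k : ℕ) : Option σ :=
    (Encodable.decode (α := σ) k).bind fun b => if R q b then some b else none
  have hS : Computable₂ S := by
    refine Primrec.to_comp (Primrec.option_bind (Primrec.decode.comp Primrec.snd) ?_)
    exact Primrec.ite (hR.comp (Primrec.fst.comp Primrec.fst) Primrec.snd)
      (Primrec.option_some.comp Primrec.snd) (Primrec.const none)
  let G (n : ℕ) : Part σ := n.rec (Part.some a₀) fun y IH => IH.bind fun i => Nat.rfindOpt (S (y, i))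
  have hG : Partrec G :=
    Partrec.nat_rec (h := fun _ q => Nat.rfindOpt (S q)) Computable.id (Computable.const a₀)
      ((Partrec.rfindOpt hS).comp Computable.snd).to₂
  have hsearch : ∀ n a b, b ∈ Nat.rfindOpt (S (n, a)) → R (n, a) b := by
    intro n a b hb
    obtain ⟨k, hk⟩ := Nat.rfindOpt_spec hb
    obtain ⟨b', -, h2⟩ := Option.bind_eq_some_iff.1 hk
    split_ifs at h2 with h3
    exact Option.some.inj h2 ▸ h3
  -- The invariant `P` need not be decidable: it is never tested, and serves only to show that each
  -- search terminates.
  have hex : ∀ n, ∃ a ∈ G n, P a := by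
    intro n
    induction n with
    | zero => exact ⟨a₀, Part.mem_some _, h₀⟩
    | succ n ih =>
      obtain ⟨a, ha, hPa⟩ := ih
      obtain ⟨b, hb⟩ := hstep n a hPa
      have hd : (Nat.rfindOpt (S (n, a))).Dom :=
        Nat.rfindOpt_dom.2 ⟨Encodable.encode b, b, by simp [S, hb]⟩
      obtain ⟨b', hb'⟩ := Part.dom_iff_mem.1 hd
      exact ⟨b', Part.mem_bind_iff.2 ⟨a, ha, hb'⟩, hP n a b' hPa (hsearch n a b' hb')⟩
  choose s hs hPs using hex
  refine ⟨s, hG.of_eq_tot hs, Part.mem_some_iff.1 (hs 0), fun n => ⟨hPs n, ?_⟩⟩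
  obtain ⟨i, hi, h⟩ := Part.mem_bind_iff.1 (hs (n + 1))
  rw [Part.mem_unique hi (hs n)] at h
  exact hsearch _ _ _ h

end Search

/-! ### Finite strings -/

section Strings

/-- All strings of length `n`. -/
def strings (n : ℕ) : List (List Bool) :=
  n.rec [[]] fun _ L => L.flatMap fun v => [v ++ [false], v ++ [true]]

theorem mem_strings {n : ℕ} {v : List Bool} : v ∈ strings n ↔ v.length = n := by
  induction n generalizing v with
  | zero => simp [strings]
  | succ n ih =>
    change v ∈ (strings n).flatMap (fun v => [v ++ [false], v ++ [true]]) ↔ _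
    simp only [List.mem_flatMap, ih, List.mem_cons, List.not_mem_nil, or_false]
    constructor
    · rintro ⟨w, rfl, rfl | rfl⟩ <;> simp
    · intro h
      rcases List.eq_nil_or_concat v with rfl | ⟨w, b, rfl⟩
      · simp at h
      · refine ⟨w, by simpa using h, ?_⟩
        cases b <;> simp

theorem primrec_strings : Primrec strings := by
  refine Primrec.nat_rec₁ _ ?_
  refine Primrec.list_flatMap Primrec.snd ?_
  have h (b : Bool) : Primrec fun p : (ℕ × List (List Bool)) × List Bool => p.2 ++ [b] :=
    Primrec.list_concat.comp Primrec.snd (Primrec.const b)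
  exact Primrec.list_cons.comp (h false) (Primrec.list_cons.comp (h true) (Primrec.const []))

theorem primrecRel_prefix : PrimrecRel fun τ ρ : List Bool => τ <+: ρ :=
  (Primrec.eq.comp Primrec.fst
    (Primrec.list_take.comp (Primrec.list_length.comp Primrec.fst) Primrec.snd)).of_eq
    fun _ => List.prefix_iff_eq_take.symm

theorem eq_restrict_of_prefix {A : ℕ → Bool} {n : ℕ} {τ : List Bool} (h : τ <+: restrict A n) :
    τ = restrict A τ.length := by
  have hl := h.length_le
  rw [length_restrict] at hl
  rw [← restrict_take hl]
  exact List.prefix_iff_eq_take.1 h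

end Strings

/-! ### Forcing with bushy computably enumerable trees -/

section Forcing

/-- A forcing condition: a computably enumerable set of strings, each of which can be continued in
it by every string of the same length, together with a nonempty member. -/
structure Condition where
  tree : Set (List Bool)
  stem : List Bool
  rePred : REPred fun σ => σ ∈ tree
  stem_mem : stem ∈ tree
  stem_ne_nil : stem ≠ []
  bushy : ∀ σ ∈ tree, ∀ v : List Bool, v.length = σ.length → ∃ ρ ∈ tree, σ ++ v <+: ρ

/-- The condition `p` is at least as strong as `q`. -/
def Condition.Extends (p q : Condition) : Prop := p.tree ⊆ q.tree ∧ q.stem <+: p.stem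

/-- Along the strings in `T`, either the functional with code `c` is undefined at some input, or it
is dominated by a computable function. -/
def Decides (T : Set (List Bool)) (c : Nat.Partrec.Code) : Prop :=
  (∃ x, ∀ ρ ∈ T, ¬(evalOracle c ρ x).Dom) ∨
    ∃ f : ℕ → ℕ, Computable f ∧ ∀ x, ∃ m, ∀ ρ ∈ T, m ≤ ρ.length →
      ∃ ρ₀, ρ₀ <+: ρ ∧ ∃ y ∈ evalOracle c ρ₀ x, y ≤ f x

theorem Decides.mono {T T' : Set (List Bool)} {c : Nat.Partrec.Code} (h : Decides T c)
    (hT : T' ⊆ T) : Decides T' c := by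
  rcases h with ⟨x, hx⟩ | ⟨f, hf, h⟩
  · exact .inl ⟨x, fun ρ hρ => hx ρ (hT hρ)⟩
  · refine .inr ⟨f, hf, fun x => ?_⟩
    obtain ⟨m, hm⟩ := h x
    exact ⟨m, fun ρ hρ => hm ρ (hT hρ)⟩

/-- `L'` is a level above the level `L` at which the functional with code `c` has converged at `n`
within `k` steps to a value below `k`, and whose members have been enumerated by stage `k`. -/
def NextLevel (c : Nat.Partrec.Code) (q : ℕ → List Bool → Prop) (n : ℕ)
    (L L' : List (List Bool)) (k : ℕ) : Prop :=
  (∀ τ ∈ L, ∀ v ∈ strings τ.length, ∃ ρ ∈ L', τ ++ v <+: ρ) ∧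
    ∀ ρ ∈ L', (∃ τ ∈ L, τ <+: ρ) ∧ q k ρ ∧
      ∃ y ∈ List.range k, c.evaln k (Nat.pair n (Encodable.encode ρ)) = some y

theorem primrecRel_nextLevel (c : Nat.Partrec.Code) {q : ℕ → List Bool → Prop}
    (hq : PrimrecRel q) :
    PrimrecRel fun (a : ℕ × List (List Bool) × ℕ) (b : List (List Bool) × ℕ) =>
      NextLevel c q a.1 a.2.1 b.1 b.2 := by
  have h1 : PrimrecRel fun (ρ : List Bool) (r : List Bool × List Bool) => r.2 ++ r.1 <+: ρ :=
    primrecRel_prefix.comp (Primrec.list_append.comp (Primrec.snd.comp Primrec.snd)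
      (Primrec.fst.comp Primrec.snd)) Primrec.fst
  have h2 : PrimrecRel fun (v : List Bool) (r : List Bool × List (List Bool)) =>
      ∃ ρ ∈ r.2, r.1 ++ v <+: ρ :=
    h1.exists_mem_list.comp (Primrec.snd.comp Primrec.snd)
      (Primrec.fst.pair (Primrec.fst.comp Primrec.snd))
  have h3 : PrimrecRel fun (τ : List Bool) (L' : List (List Bool)) =>
      ∀ v ∈ strings τ.length, ∃ ρ ∈ L', τ ++ v <+: ρ :=
    h2.forall_mem_list.comp (primrec_strings.comp (Primrec.list_length.comp Primrec.fst))
      Primrec.id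
  have h4 : PrimrecRel fun (ρ : List Bool) (r : (ℕ × List (List Bool)) × ℕ) =>
      (∃ τ ∈ r.1.2, τ <+: ρ) ∧ q r.2 ρ ∧
        ∃ y ∈ List.range r.2, c.evaln r.2 (Nat.pair r.1.1 (Encodable.encode ρ)) = some y := by
    refine (primrecRel_prefix.exists_mem_list.comp
      (Primrec.snd.comp (Primrec.fst.comp Primrec.snd)) Primrec.fst).and
      ((hq.comp (Primrec.snd.comp Primrec.snd) Primrec.fst).and ?_)
    have h5 : PrimrecRel fun (y : ℕ) (r : (ℕ × ℕ) × List Bool) =>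
        c.evaln r.1.2 (Nat.pair r.1.1 (Encodable.encode r.2)) = some y :=
      Primrec.eq.comp (Nat.Partrec.Code.primrec_evaln.comp
        (((Primrec.snd.comp (Primrec.fst.comp Primrec.snd)).pair (Primrec.const c)).pair
          (Primrec₂.natPair.comp (Primrec.fst.comp (Primrec.fst.comp Primrec.snd))
            (Primrec.encode.comp (Primrec.snd.comp Primrec.snd)))))
        (Primrec.option_some.comp Primrec.fst)
    exact h5.exists_mem_list.comp (Primrec.list_range.comp (Primrec.snd.comp Primrec.snd))
      (((Primrec.fst.comp (Primrec.fst.comp Primrec.snd)).pair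
        (Primrec.snd.comp Primrec.snd)).pair Primrec.fst)
  exact (h3.forall_mem_list.comp (Primrec.fst.comp (Primrec.snd.comp Primrec.fst))
    (Primrec.fst.comp Primrec.snd)).and
    (h4.forall_mem_list.comp (Primrec.fst.comp Primrec.snd)
      (((Primrec.fst.comp Primrec.fst).pair
        (Primrec.fst.comp (Primrec.snd.comp Primrec.fst))).pair (Primrec.snd.comp Primrec.snd)))

/-- Only finitely many strings `τ ++ v` have to be continued. One witness is chosen for each, and
then a stage `k` late enough for all of them at once. -/
theorem exists_nextLevel {T : Set (List Bool)} {c : Nat.Partrec.Code}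
    {q : ℕ → List Bool → Prop} (hmono : ∀ m n a, m ≤ n → q m a → q n a)
    (hq : ∀ ρ, ρ ∈ T ↔ ∃ k, q k ρ) {n : ℕ} {L : List (List Bool)}
    (h : ∀ τ ∈ L, ∀ v : List Bool, v.length = τ.length →
      ∃ ρ ∈ T, τ ++ v <+: ρ ∧ (evalOracle c ρ n).Dom) :
    ∃ L' k, NextLevel c q n L L' k := by
  have h' : ∀ τ v : List Bool, ∃ ρ, τ ∈ L → v.length = τ.length →
      ρ ∈ T ∧ τ ++ v <+: ρ ∧ (evalOracle c ρ n).Dom := by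
    intro τ v
    by_cases h1 : τ ∈ L ∧ v.length = τ.length
    · obtain ⟨ρ, hρ⟩ := h τ h1.1 v h1.2
      exact ⟨ρ, fun _ _ => hρ⟩
    · exact ⟨[], fun h2 h3 => absurd ⟨h2, h3⟩ h1⟩
  choose ρ hρ using h'
  let L' := L.flatMap fun τ => (strings τ.length).map (ρ τ)
  have hL' : ∀ ξ ∈ L', ξ ∈ T ∧ (∃ τ ∈ L, τ <+: ξ) ∧ (evalOracle c ξ n).Dom := by
    intro ξ hξ
    obtain ⟨τ, hτ, h2⟩ := List.mem_flatMap.1 hξ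
    obtain ⟨v, hv, rfl⟩ := List.mem_map.1 h2
    obtain ⟨h3, h4, h5⟩ := hρ τ v hτ (mem_strings.1 hv)
    exact ⟨h3, ⟨τ, hτ, (List.prefix_append _ _).trans h4⟩, h5⟩
  have hev : ∀ᶠ k in atTop, ∀ ξ ∈ {ξ | ξ ∈ L'}, q k ξ ∧
      ∃ y ∈ List.range k, c.evaln k (Nat.pair n (Encodable.encode ξ)) = some y := by
    refine (eventually_all_finite (List.finite_toSet L')).2 fun ξ hξ => ?_
    obtain ⟨h3, -, h5⟩ := hL' ξ hξ
    obtain ⟨k, hk⟩ := (hq ξ).1 h3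
    obtain ⟨y, hy⟩ := Part.dom_iff_mem.1 h5
    obtain ⟨l, hl⟩ := Nat.Partrec.Code.evaln_complete.1 hy
    filter_upwards [eventually_ge_atTop k, eventually_ge_atTop l, eventually_gt_atTop y]
      with m h6 h7 h8
    exact ⟨hmono _ _ _ h6 hk, y, List.mem_range.2 h8, Nat.Partrec.Code.evaln_mono h7 hl⟩
  obtain ⟨k, hk⟩ := hev.exists
  refine ⟨L', k, fun τ hτ v hv => ?_, fun ξ hξ => ⟨(hL' ξ hξ).2.1, hk ξ hξ⟩⟩
  exact ⟨ρ τ v, List.mem_flatMap.2 ⟨τ, hτ, List.mem_map_of_mem hv⟩,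
    (hρ τ v hτ (mem_strings.1 hv)).2.1⟩

/-- Passing to the part of a condition above one of its strings. -/
theorem Condition.exists_above (p : Condition) {σ : List Bool} (hσ : σ ∈ p.tree)
    (h : p.stem <+: σ) :
    ∃ q : Condition, q.Extends p ∧ ∀ ρ ∈ q.tree, ρ ∈ p.tree ∧ σ <+: ρ := by
  obtain ⟨t, ht, -, htp⟩ := p.rePred.exists_stages
  classical
  refine ⟨⟨{ρ | ρ ∈ p.tree ∧ σ <+: ρ}, σ, ?_, ⟨hσ, List.prefix_rfl⟩, ?_, ?_⟩,
    ⟨fun ρ hρ => hρ.1, h⟩, fun ρ hρ => hρ⟩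
  · have h1 : PrimrecPred fun a : List Bool × ℕ => t a.2 a.1 ∧ σ <+: a.1 :=
      (ht.comp Primrec.snd Primrec.fst).and
        (primrecRel_prefix.comp (Primrec.const σ) Primrec.fst)
    refine REPred.of_exists (t := fun ρ k => decide (t k ρ ∧ σ <+: ρ)) ?_ fun ρ => ?_
    · exact h1.decide.to_comp
    · simp [htp]
  · rintro rfl
    exact p.stem_ne_nil (List.prefix_nil.1 h)
  · rintro ρ ⟨h1, h2⟩ v hv
    obtain ⟨ξ, hξ, h3⟩ := p.bushy ρ h1 v hv
    exact ⟨ξ, ⟨hξ, h2.trans ((List.prefix_append _ _).trans h3)⟩, h3⟩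

/-- If the functional with code `c` cannot be made undefined, a condition can be thinned out so
that the functional becomes total and computably dominated. -/
theorem Condition.exists_thinning (p : Condition) {c : Nat.Partrec.Code}
    (h : ∀ σ ∈ p.tree, p.stem <+: σ → ∀ x, ∃ ρ ∈ p.tree, σ <+: ρ ∧ (evalOracle c ρ x).Dom) :
    ∃ q : Condition, q.Extends p ∧ Decides q.tree c := by
  obtain ⟨t, ht, hmono, htp⟩ := p.rePred.exists_stages
  obtain ⟨s, hs, hs0, hsn⟩ := exists_computable_seq (primrecRel_nextLevel c ht)
    (P := fun a => ∀ τ ∈ a.1, τ ∈ p.tree ∧ p.stem <+: τ) (a₀ := ([p.stem], 0))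
    (by simp [p.stem_mem])
    (fun n a ha => by
      obtain ⟨L', k, hk⟩ := exists_nextLevel (c := c) (n := n) (L := a.1) hmono htp
        fun τ hτ v hv => by
          obtain ⟨ρ, hρ, h1⟩ := p.bushy τ (ha τ hτ).1 v hv
          obtain ⟨ξ, hξ, h2, h3⟩ := h ρ hρ
            ((ha τ hτ).2.trans ((List.prefix_append _ _).trans h1)) n
          exact ⟨ξ, hξ, h1.trans h2, h3⟩
      exact ⟨(L', k), hk⟩)
    (fun n a b ha hab τ hτ => by
      obtain ⟨⟨ρ, hρ, h1⟩, h2, -⟩ := hab.2 τ hτ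
      exact ⟨(htp τ).2 ⟨_, h2⟩, (ha ρ hρ).2.trans h1⟩)
  have hdesc : ∀ m n, m ≤ n → ∀ ρ ∈ (s n).1, ∃ ρ₀ ∈ (s m).1, ρ₀ <+: ρ := by
    intro m n hmn
    induction n, hmn using Nat.le_induction with
    | base => exact fun ρ hρ => ⟨ρ, hρ, List.prefix_rfl⟩
    | succ n _ ih =>
      intro ρ hρ
      obtain ⟨τ, hτ, h1⟩ := ((hsn n).2.2 ρ hρ).1
      obtain ⟨ρ₀, hρ₀, h2⟩ := ih τ hτ
      exact ⟨ρ₀, hρ₀, h2.trans h1⟩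
  classical
  refine ⟨⟨{σ | ∃ n, σ ∈ (s n).1}, p.stem, ?_, ⟨0, by simp [hs0]⟩, p.stem_ne_nil, ?_⟩,
    ⟨?_, List.prefix_rfl⟩, .inr ⟨fun x => (s (x + 1)).2, ?_, fun x => ?_⟩⟩
  · refine REPred.of_exists (t := fun σ n => decide (∃ τ ∈ (s n).1, τ = σ)) ?_ fun σ => ?_
    · have h1 : PrimrecRel fun (L : List (List Bool)) (σ : List Bool) => ∃ τ ∈ L, τ = σ :=
        PrimrecRel.exists_mem_list Primrec.eq
      exact h1.decide.to_comp.comp (Computable.fst.comp (hs.comp Computable.snd)) Computable.fst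
    · simp
  · rintro σ ⟨n, hσ⟩ v hv
    obtain ⟨ρ, hρ, h1⟩ := (hsn n).2.1 σ hσ v (mem_strings.2 hv)
    exact ⟨ρ, ⟨n + 1, hρ⟩, h1⟩
  · rintro σ ⟨n, hσ⟩
    exact ((hsn n).1 σ hσ).1
  · exact Computable.snd.comp (hs.comp Computable.succ)
  -- The levels up to `x` are finite, so a long enough member lies in a level above `x`. It then
  -- extends a string of level `x + 1`, on which the functional converges at `x` to a value below
  -- the stage of that level.
  · have hfin : (⋃ n ∈ Set.Iic x, {ρ | ρ ∈ (s n).1}).Finite :=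
      (Set.finite_Iic x).biUnion fun n _ => List.finite_toSet _
    obtain ⟨m, hm⟩ := (hfin.image List.length).bddAbove
    refine ⟨m + 1, ?_⟩
    rintro ρ ⟨n, hρ⟩ hmρ
    have hxn : x + 1 ≤ n := by
      by_contra hlt
      have := hm ⟨ρ, Set.mem_biUnion (show n ∈ Set.Iic x from by simp; omega) hρ, rfl⟩
      omega
    obtain ⟨ρ₀, hρ₀, h1⟩ := hdesc _ _ hxn ρ hρ
    obtain ⟨-, -, y, hy, h2⟩ := (hsn x).2.2 ρ₀ hρ₀
    exact ⟨ρ₀, h1, y, Nat.Partrec.Code.evaln_sound h2, (List.mem_range.1 hy).le⟩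

theorem Condition.exists_decides (p : Condition) (c : Nat.Partrec.Code) :
    ∃ q : Condition, q.Extends p ∧ Decides q.tree c := by
  by_cases h : ∀ σ ∈ p.tree, p.stem <+: σ → ∀ x,
      ∃ ρ ∈ p.tree, σ <+: ρ ∧ (evalOracle c ρ x).Dom
  · exact p.exists_thinning h
  · push Not at h
    obtain ⟨σ, hσ, hpσ, x, hx⟩ := h
    obtain ⟨q, hq, hqσ⟩ := p.exists_above hσ hpσ
    exact ⟨q, hq, .inl ⟨x, fun ρ hρ => hx ρ (hqσ ρ hρ).1 (hqσ ρ hρ).2⟩⟩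

/-- One step of the construction: decide a functional, and then follow a given real for as many
bits as have been chosen before. -/
theorem Condition.exists_step (p : Condition) (c : Nat.Partrec.Code) (B : ℕ → Bool) :
    ∃ r : Condition, r.Extends p ∧ Decides r.tree c ∧
      ∃ σ : List Bool, p.stem.length ≤ σ.length ∧ σ ++ restrict B σ.length <+: r.stem := by
  obtain ⟨q, hqp, hq⟩ := p.exists_decides c
  obtain ⟨ρ, hρ, h⟩ := q.bushy q.stem q.stem_mem _ (length_restrict B _)
  have hqρ : q.stem <+: ρ := (List.prefix_append _ _).trans h
  refine ⟨⟨q.tree, ρ, q.rePred, hρ, ?_, q.bushy⟩, ⟨hqp.1, hqp.2.trans hqρ⟩, hq,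
    q.stem, hqp.2.length_le, h⟩
  rintro rfl
  exact q.stem_ne_nil (List.prefix_nil.1 hqρ)

/-- The condition that leaves everything open. -/
def Condition.full : Condition where
  tree := Set.univ
  stem := [false]
  rePred := REPred.of_exists (t := fun _ _ => true) (Computable.const true) (by simp)
  stem_mem := trivial
  stem_ne_nil := by simp
  bushy := fun σ _ v _ => ⟨σ ++ v, trivial, List.prefix_rfl⟩

/-! ### The limit of the construction -/

theorem exists_real_of_prefix_chain {τ : ℕ → List Bool} (h : ∀ i, τ i <+: τ (i + 1))
    (hlen : ∀ i, i < (τ i).length) : ∃ A : ℕ → Bool, ∀ i, restrict A (τ i).length = τ i := by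
  have hmono : ∀ i j, i ≤ j → τ i <+: τ j := by
    intro i j hij
    induction j, hij using Nat.le_induction with
    | base => exact List.prefix_rfl
    | succ j _ ih => exact ih.trans (h j)
  have hget : ∀ i j n (hi : n < (τ i).length) (hj : n < (τ j).length), (τ i)[n] = (τ j)[n] := by
    intro i j n hi hj
    rcases le_total i j with hij | hij
    · exact (hmono i j hij).getElem hi
    · exact ((hmono j i hij).getElem hj).symm
  refine ⟨fun n => (τ n)[n]'(hlen n), fun i => ?_⟩
  apply List.ext_getElem (length_restrict _ _)
  intro n h1 h2
  simpa [restrict] using hget n i n (hlen n) h2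

/-- Step `i` decides the functional with code `i` and copies the real indexed by the first component
of `i`, so every functional is decided and every real is copied infinitely often. -/
theorem exists_hyperimmuneFree_forall_notMem_SR (X : ℕ → Bool) :
    ∃ A : ℕ → Bool, HyperimmuneFree A ∧ ∀ B : ℕ → Bool, ComputableFrom X B → B ∉ SR A := by
  obtain ⟨B, hB⟩ := exists_enumeration X
  choose step hext hdec σ hσ hσr using fun (i : ℕ) (p : Condition) =>
    p.exists_step (Denumerable.ofNat Nat.Partrec.Code i) (B i.unpair.1)
  let P (n : ℕ) : Condition := n.rec Condition.full step
  have hPs : ∀ n, P (n + 1) = step n (P n) := fun _ => rfl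
  have hpre : ∀ n, (P n).stem <+: (P (n + 1)).stem := fun n => (hext n (P n)).2
  have htree : ∀ i j, i ≤ j → (P j).tree ⊆ (P i).tree := by
    intro i j hij
    induction j, hij using Nat.le_induction with
    | base => exact subset_rfl
    | succ j _ ih => exact (hext j (P j)).1.trans ih
  -- Copying as many bits as are already present at least doubles the stem, which starts nonempty;
  -- an empty stem could stall.
  have hlen : ∀ n, n < (P n).stem.length := by
    intro n
    induction n with
    | zero => exact List.length_pos_iff.2 (P 0).stem_ne_nil
    | succ n ih =>
      have h1 := hσ n (P n)
      have h2 := (hσr n (P n)).length_le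
      rw [List.length_append, length_restrict, ← hPs] at h2
      omega
  obtain ⟨A, hA⟩ := exists_real_of_prefix_chain hpre hlen
  refine ⟨A, fun g hg => ?_, fun Y hY => ?_⟩
  · obtain ⟨c, hc⟩ := exists_code_approximates (ComputableFrom.nat hg)
    have hd := hdec (Encodable.encode c) (P (Encodable.encode c))
    rw [← hPs, Denumerable.ofNat_encode] at hd
    have hmem : ∀ n, ∃ j, n ≤ (P j).stem.length ∧
        (P j).stem ∈ (P (Encodable.encode c + 1)).tree := by
      intro n
      refine ⟨max n (Encodable.encode c + 1), (le_max_left _ _).trans (hlen _).le, ?_⟩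
      exact htree _ _ (le_max_right n (Encodable.encode c + 1)) (P _).stem_mem
    rcases hd with ⟨x, hx⟩ | ⟨f, hf, h⟩
    -- Divergence is impossible: `g x` is computed from a prefix of `A`, hence from every longer
    -- stem, and late stems lie in the tree.
    · obtain ⟨n, hn⟩ := (hc.mem_iff x (g x)).1 (Part.mem_some _)
      obtain ⟨j, hj, hjm⟩ := hmem n
      refine absurd ?_ (hx _ hjm)
      have := hc.mono hj hn
      rw [hA] at this
      exact Part.dom_iff_mem.2 ⟨_, this⟩
    · refine ⟨f, hf, fun x => ?_⟩
      obtain ⟨m, hm⟩ := h x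
      obtain ⟨j, hj, hjm⟩ := hmem m
      obtain ⟨ρ₀, hρ₀, y, hy, hyf⟩ := hm _ hjm hj
      rw [← hA j] at hρ₀
      rw [eq_restrict_of_prefix hρ₀] at hy
      have : y ∈ (g : ℕ →. ℕ) x := (hc.mem_iff x y).2 ⟨_, hy⟩
      rwa [← Part.mem_some_iff.1 this]
  · obtain ⟨e, rfl⟩ := hB Y hY
    refine notMem_SR_of_frequently fun n => ?_
    -- The step `Nat.pair e n` copies `B e` and is at least `n`, so the copied block is longer than
    -- `n`.
    set i := Nat.pair e n with hi
    have h1 := hσr i (P i)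
    have h2 := hσ i (P i)
    rw [← hPs, ← hA (i + 1), hi, Nat.unpair_pair, ← hi] at h1
    refine ⟨(σ i (P i)).length, ?_, ?_⟩
    · have := Nat.right_le_pair e n
      have := hlen i
      omega
    · have h3 := eq_restrict_of_prefix h1
      -- With `k` the length of `σ`, the copy occupies the bits `k, …, 2k - 1`, which is the block
      -- with index `k`.
      rw [List.length_append, length_restrict, ← two_mul] at h3
      rw [block, ← h3, listBlock, List.take_of_length_le, List.drop_left]
      rw [List.length_append, length_restrict, two_mul]

end Forcing

end Schnorr

end

theorem mainTheorem4 :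
    (∀ X : ℕ → Bool, ∃ A : ℕ → Bool, Schnorr.HyperimmuneFree A ∧
      ∀ B : ℕ → Bool, Schnorr.ComputableFrom X B → B ∉ Schnorr.SR A) ∧
    (∀ A : ℕ → Bool, Schnorr.HyperimmuneFree A → Schnorr.ArrayComputable A) ∧
    (∀ U : List Bool →. List Bool, Schnorr.IsUniversalPrefixMachine U →
      ∃ A : ℕ → Bool, Schnorr.ArrayComputable A ∧ Schnorr.Omega U ∉ Schnorr.SR A) := by
  refine ⟨Schnorr.exists_hyperimmuneFree_forall_notMem_SR, fun _ h => h.arrayComputable,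
    fun U _ => ?_⟩
  -- `Ω` is computable from itself, so `X = Ω` suffices.
  obtain ⟨A, hA, h⟩ := Schnorr.exists_hyperimmuneFree_forall_notMem_SR (Schnorr.Omega U)
  exact ⟨A, hA.arrayComputable, h _ (Schnorr.computableFrom_self _)⟩
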